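/- Let $G$ be a finite graph with vertex set $V(G)$ and edge set $E(G)$ (loops and parallel edges are allowed). For $C\subseteq E(G)$ let $G\langle C\rangle$ be the subgraph of $G$ formed by the edges in $C$ and their end vertices. For $k\ge 1$ let $M_k(G)$, the $k$-circular matroid of $G$, be the matroid on $E(G)$ whose circuits are the sets $C\subseteq E(G)$ such that $|C|-|V(G\langle C\rangle)|=k$ and $G\langle C\rangle$ has no isolated vertices, no vertices of degree one (a loop contributes two to the degree), and no connected component that is a cycle. Let $\rho_k^*(G)$ denote the corank of $M_k(G)$, i.e. the rank of its dual matroid. A matroid is connected if it has no loops, no coloops, and every two of its elements belong to a common circuit; a cocircuit $K$ of a connected matroid $M$ is non-separating if $M\setminus K$ is connected. The star of a vertex $x$ is the set of all edges incident to $x$. The graph $G$ is $3$-connected if $|V(G)|\ge 4$ and $G\setminus X$ is connected for every $X\subseteq V(G)$ with $|X|\le 2$. **Theorem.** Let $G$ be a finite $3$-connected graph, let $k\ge 1$, and suppose that $|E(G)|-|V(G)|\ge k$. Then the set of non-separating cocircuits of $M_k(G)$ is equal to the set of those vertex stars $S$ of $G$ for which $|S|\le\rho_k^*(G)$. -/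

import Mathlib

open scoped Graph Matroid

namespace KCircular

variable {α β : Type*}

/-- The degree of a vertex: the number of incident edges, a loop being counted twice. -/
noncomputable def degree (G : Graph α β) (x : α) : ℕ∞ :=
  (G.incidenceSet x).encard + (G.loopSet x).encard

/-- A graph is connected if it has a vertex and any two of its vertices are joined by a walk. -/
def Connected (G : Graph α β) : Prop :=
  V(G).Nonempty ∧ ∀ x ∈ V(G), ∀ y ∈ V(G), Relation.ReflTransGen G.Adj x y

/-- A graph is `3`-connected if it has at least four vertices and stays connected after the
deletion of any set of at most two vertices (loops and parallel edges are not forbidden). -/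
def IsThreeConnected (G : Graph α β) : Prop :=
  4 ≤ V(G).encard ∧ ∀ X ⊆ V(G), X.encard ≤ 2 → Connected (G.deleteVerts X)

/-- `H` is a connected component of `G`. -/
def IsComponent (H G : Graph α β) : Prop :=
  H ≤c G ∧ Connected H

/-- A (finite) graph is a cycle if it is connected and `2`-regular. A single loop and a pair of
parallel edges are the cycles of length one and two. -/
def IsCycle (H : Graph α β) : Prop :=
  Connected H ∧ ∀ x ∈ V(H), degree H x = 2

/-- A cacti-graph: no isolated vertices, no leaves and no cycle components. -/
def IsCactiGraph (G : Graph α β) : Prop :=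
  (∀ x ∈ V(G), degree G x ≠ 0) ∧ (∀ x ∈ V(G), degree G x ≠ 1) ∧
    ∀ H, IsComponent H G → ¬ IsCycle H

/-- `Δ G = |E(G)| - |V(G)|` (for a finite graph). -/
noncomputable def excess (G : Graph α β) : ℤ :=
  (E(G).ncard : ℤ) - (V(G).ncard : ℤ)

/-- The set of vertices incident to an edge in `X`. -/
def ends (G : Graph α β) (X : Set β) : Set α := {x | ∃ e ∈ X, G.Inc e x}

/-- The subgraph `G⟨X⟩` of `G` induced by a set `X` of edges: its edges are those in `X`, and its
vertices are the ends of these edges. -/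
def edgeSubgraph (G : Graph α β) (X : Set β) : Graph α β where
  vertexSet := ends G X
  IsLink e x y := e ∈ X ∧ G.IsLink e x y
  edgeSet := E(G) ∩ X
  isLink_symm _ _ := ⟨fun _ _ h ↦ ⟨h.1, h.2.symm⟩⟩
  eq_or_eq_of_isLink_of_isLink _ _ _ _ _ h h' := h.2.left_eq_or_eq h'.2
  edge_mem_iff_exists_isLink e :=
    ⟨fun h ↦ by
      obtain ⟨x, y, hxy⟩ := Graph.exists_isLink_of_mem_edgeSet h.1
      exact ⟨x, y, h.2, hxy⟩, fun ⟨_, _, h⟩ ↦ ⟨h.2.edge_mem, h.1⟩⟩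
  left_mem_of_isLink e _ _ h := ⟨e, h.1, h.2.inc_left⟩

/-- The family `𝒞ₖ(G)`: sets `C` of edges such that `Δ (G⟨C⟩) = k` and `G⟨C⟩` is a
cacti-graph. -/
def IsKCircuit (G : Graph α β) (k : ℕ) (C : Set β) : Prop :=
  C ⊆ E(G) ∧ excess (edgeSubgraph G C) = k ∧ IsCactiGraph (edgeSubgraph G C)

/-! ### The sets in `𝒞ₖ(G)` are the circuits of a matroid -/

lemma edgeSubgraph_inc {G : Graph α β} {X : Set β} {e : β} {x : α} :
    (edgeSubgraph G X).Inc e x ↔ e ∈ X ∧ G.Inc e x :=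
  ⟨fun ⟨y, h⟩ ↦ ⟨h.1, y, h.2⟩, fun ⟨h, y, h'⟩ ↦ ⟨y, h, h'⟩⟩

lemma ends_mono {G : Graph α β} {X Y : Set β} (h : X ⊆ Y) : ends G X ⊆ ends G Y :=
  fun _ ⟨e, he, hx⟩ ↦ ⟨e, h he, hx⟩

lemma ends_union (G : Graph α β) (X Y : Set β) : ends G (X ∪ Y) = ends G X ∪ ends G Y := by
  ext x
  simp only [ends, Set.mem_ofPred_eq, Set.mem_union]
  grind

lemma ends_finite (G : Graph α β) {X : Set β} (hX : X.Finite) : (ends G X).Finite := by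
  have : ends G X = ⋃ e ∈ X, {x | G.Inc e x} := by ext x; simp [ends]
  rw [this]
  refine hX.biUnion fun e _ ↦ ?_
  by_cases he : e ∈ E(G)
  · obtain ⟨x, y, h⟩ := Graph.exists_isLink_of_mem_edgeSet he
    exact ((Set.finite_singleton y).insert x).subset fun z hz ↦ by
      simpa using hz.eq_or_eq_of_isLink h
  · convert Set.finite_empty
    ext x
    simpa using fun h : G.Inc e x ↦ he h.edge_mem

lemma excess_edgeSubgraph {G : Graph α β} {X : Set β} (hX : X ⊆ E(G)) :
    excess (edgeSubgraph G X) = (X.ncard : ℤ) - ((ends G X).ncard : ℤ) := by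
  have : E(edgeSubgraph G X) = X := Set.inter_eq_right.2 hX
  rw [excess, this]
  rfl

/-- The contribution of the edge `e` to the sum of the degrees of the vertices in `W`. -/
lemma sum_ends [DecidableEq α] {G : Graph α β} {e : β} {x y : α} (h : G.IsLink e x y)
    (W : Finset α) [DecidablePred fun z ↦ G.Inc e z] [DecidablePred fun z ↦ G.IsLoopAt e z] :
    (W.filter fun z ↦ G.Inc e z).card + (W.filter fun z ↦ G.IsLoopAt e z).card =
      (if x ∈ W then 1 else 0) + (if y ∈ W then 1 else 0) := by
  have hinc : ∀ z, G.Inc e z ↔ z = x ∨ z = y := fun z ↦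
    ⟨fun hz ↦ hz.eq_or_eq_of_isLink h, by rintro (rfl | rfl); exacts [h.inc_left, h.inc_right]⟩
  by_cases hxy : x = y
  · subst hxy
    have hl : ∀ z, G.IsLoopAt e z ↔ z = x := fun z ↦
      ⟨fun hz ↦ by simpa using (hinc z).1 hz.inc, by rintro rfl; exact h⟩
    simp [hinc, hl, Finset.filter_eq']
    split_ifs <;> simp
  · have hl : ∀ z, ¬ G.IsLoopAt e z := fun z hz ↦ by
      have h1 := hz.eq_of_inc h.inc_left
      have h2 := hz.eq_of_inc h.inc_right
      exact hxy (h1.symm.trans h2)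
    simp only [hinc, hl, Finset.filter_or, Finset.filter_eq', Finset.filter_false]
    rw [Finset.card_union_of_disjoint]
    · split_ifs <;> simp
    · split_ifs <;> simp [hxy]

/-- Double counting of the incidences between a finite set `F` of edges and a finite set `W` of
vertices of which every incident edge lies in `F`. -/
lemma degree_count {G : Graph α β} {W : Set α} {F : Set β} (hW : W.Finite) (hF : F.Finite)
    (hFE : F ⊆ E(G)) (hWF : ∀ x ∈ W, G.incidenceSet x ⊆ F) (hdeg : ∀ x ∈ W, 2 ≤ degree G x) :
    W.ncard ≤ F.ncard ∧ (W.ncard = F.ncard →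
      (∀ x ∈ W, degree G x = 2) ∧ ∀ e ∈ F, ∀ x, G.Inc e x → x ∈ W) := by
  classical
  lift W to Finset α using hW
  lift F to Finset β using hF
  simp only [Finset.mem_coe] at *
  set d : α → ℕ := fun x ↦
    (F.filter fun e ↦ G.Inc e x).card + (F.filter fun e ↦ G.IsLoopAt e x).card with hd
  set c : β → ℕ := fun e ↦
    (W.filter fun x ↦ G.Inc e x).card + (W.filter fun x ↦ G.IsLoopAt e x).card with hc
  have hdd : ∀ x ∈ W, degree G x = d x := by
    intro x hx
    have h1 : G.incidenceSet x = (F.filter fun e ↦ G.Inc e x : Finset β) := by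
      ext e
      simpa using fun he : G.Inc e x ↦ Finset.mem_coe.1 (hWF x hx he)
    have h2 : G.loopSet x = (F.filter fun e ↦ G.IsLoopAt e x : Finset β) := by
      ext e
      simpa using fun he : G.IsLoopAt e x ↦ Finset.mem_coe.1 (hWF x hx he.inc)
    rw [degree, h1, h2, Set.encard_coe_eq_coe_finsetCard, Set.encard_coe_eq_coe_finsetCard, hd]
    push_cast
    rfl
  have hsum : ∑ x ∈ W, d x = ∑ e ∈ F, c e := by
    simp only [hd, hc, Finset.sum_add_distrib, Finset.card_filter]
    rw [Finset.sum_comm, Finset.sum_comm (s := W)]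
  have hd2 : ∀ x ∈ W, 2 ≤ d x := fun x hx ↦ by
    have := hdeg x hx
    rw [hdd x hx] at this
    exact_mod_cast this
  have hc' : ∀ e ∈ F, c e ≤ 2 ∧ (c e = 2 → ∀ x, G.Inc e x → x ∈ W) := by
    intro e he
    obtain ⟨x, y, h⟩ := Graph.exists_isLink_of_mem_edgeSet (hFE he)
    have := sum_ends h W
    simp only [hc, this]
    refine ⟨by split_ifs <;> simp, fun h2 z hz ↦ ?_⟩
    rcases hz.eq_or_eq_of_isLink h with rfl | rfl <;> by_contra hzW <;> simp [hzW] at h2 <;>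
      split_ifs at h2 <;> simp at h2
  have h1 : ∑ x ∈ W, 2 ≤ ∑ x ∈ W, d x := Finset.sum_le_sum hd2
  have h2 : ∑ e ∈ F, c e ≤ ∑ e ∈ F, 2 := Finset.sum_le_sum fun e he ↦ (hc' e he).1
  have h1' := h1
  have h2' := h2
  simp only [Finset.sum_const, smul_eq_mul] at h1' h2'
  simp only [Set.ncard_coe_finset]
  refine ⟨by omega, fun heq ↦ ⟨fun x hx ↦ ?_, fun e he ↦ ?_⟩⟩
  · have := (Finset.sum_eq_sum_iff_of_le hd2).1 (by simp; omega) x hx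
    rw [hdd x hx, ← this]
    rfl
  · exact (hc' e he).2 ((Finset.sum_eq_sum_iff_of_le fun e he ↦ (hc' e he).1).1
      (by simp; omega) e he)

lemma closed_degree {H G : Graph α β} (h : H ≤c G) {x : α} (hx : x ∈ V(H)) :
    degree H x = degree G x := by
  have h1 : H.incidenceSet x = G.incidenceSet x := by
    ext e
    exact Graph.IsClosedSubgraph.inc_congr hx h
  have h2 : H.loopSet x = G.loopSet x := by
    ext e
    exact Graph.IsClosedSubgraph.isLink_congr hx h
  rw [degree, degree, h1, h2]

/-- A set of edges with `|Y| ≥ |V(G⟨Y⟩)| + k` that is minimal with this property is in `𝒞ₖ(G)`. -/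
lemma isKCircuit_of_minimal {G : Graph α β} (hE : E(G).Finite) {k : ℕ} (hk : 1 ≤ k) {Y : Set β}
    (hYE : Y ⊆ E(G)) (hY : (ends G Y).ncard + k ≤ Y.ncard)
    (hmin : ∀ Z ⊂ Y, Z.ncard < (ends G Z).ncard + k) : IsKCircuit G k Y := by
  have hfin := hE.subset hYE
  have hdel : ∀ e ∈ Y, Y.ncard ≤ (ends G (Y \ {e})).ncard + k := fun e he ↦ by
    have h1 := hmin (Y \ {e}) (Set.sdiff_singleton_ssubset.2 he)
    have h2 := Set.ncard_sdiff_singleton_add_one he hfin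
    omega
  have hne : Y.Nonempty := by
    rw [Set.nonempty_iff_ne_empty]
    rintro rfl
    simp at hY
    omega
  refine ⟨hYE, ?_, fun x hx h0 ↦ ?_, fun x hx h1 ↦ ?_, fun H hH hcyc ↦ ?_⟩
  · obtain ⟨e, he⟩ := hne
    have h1 := hdel e he
    have h2 := Set.ncard_le_ncard (ends_mono (G := G) (Set.sdiff_subset (s := Y) (t := {e})))
      (ends_finite G hfin)
    rw [excess_edgeSubgraph hYE]
    omega
  · obtain ⟨e, he, hex⟩ := hx
    simp only [degree, add_eq_zero, Set.encard_eq_zero] at h0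
    exact (Set.eq_empty_iff_forall_notMem.1 h0.1) e (edgeSubgraph_inc.2 ⟨he, hex⟩)
  · obtain ⟨e, he, hex⟩ := hx
    have hmem : e ∈ (edgeSubgraph G Y).incidenceSet x := edgeSubgraph_inc.2 ⟨he, hex⟩
    have hle : ((edgeSubgraph G Y).incidenceSet x).encard ≤ 1 := by
      rw [← h1, degree]
      exact le_self_add
    have huniq := Set.encard_le_one_iff.1 hle
    have hsub : ends G (Y \ {e}) ⊆ ends G Y \ {x} := by
      rintro y ⟨f, hf, hfy⟩
      refine ⟨⟨f, hf.1, hfy⟩, ?_⟩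
      rintro rfl
      exact hf.2 (huniq f e (edgeSubgraph_inc.2 ⟨hf.1, hfy⟩) hmem)
    have h2 := Set.ncard_le_ncard hsub ((ends_finite G hfin).sdiff)
    have h3 := Set.ncard_sdiff_singleton_add_one (s := ends G Y) ⟨e, he, hex⟩ (ends_finite G hfin)
    have h4 := hdel e he
    omega
  · obtain ⟨hcl, ⟨x, hx⟩, -⟩ := hH
    have hEH : E(H) ⊆ Y := fun e he ↦ (hcl.le.edgeSet_mono he).2
    have hVH : V(H) ⊆ ends G Y := hcl.le.vertexSet_mono
    have hcard : E(H).ncard ≤ V(H).ncard := by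
      -- every edge of `H` has two ends in `H`, and every vertex of `H` has degree two
      classical
      have hVfin := (ends_finite G hfin).subset hVH
      have hEfin := hfin.subset hEH
      obtain ⟨W, hW⟩ : ∃ W : Finset α, (W : Set α) = V(H) := ⟨hVfin.toFinset, by simp⟩
      obtain ⟨F, hF⟩ : ∃ F : Finset β, (F : Set β) = E(H) := ⟨hEfin.toFinset, by simp⟩
      rw [← hW, ← hF, Set.ncard_coe_finset, Set.ncard_coe_finset]
      have hsum : ∑ x ∈ W, ((F.filter fun e ↦ H.Inc e x).card +
            (F.filter fun e ↦ H.IsLoopAt e x).card) =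
          ∑ e ∈ F, ((W.filter fun x ↦ H.Inc e x).card +
            (W.filter fun x ↦ H.IsLoopAt e x).card) := by
        simp only [Finset.sum_add_distrib, Finset.card_filter]
        rw [Finset.sum_comm, Finset.sum_comm (s := W)]
      have hl : ∀ x ∈ W, ((F.filter fun e ↦ H.Inc e x).card +
          (F.filter fun e ↦ H.IsLoopAt e x).card) = 2 := by
        intro x hx
        have h2 := hcyc.2 x (hW ▸ Finset.mem_coe.2 hx)
        have h1 : H.incidenceSet x = (F.filter fun e ↦ H.Inc e x : Finset β) := by
          ext e
          have : H.Inc e x → e ∈ F := fun he ↦ Finset.mem_coe.1 (hF ▸ he.edge_mem)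
          simpa using this
        have h3 : H.loopSet x = (F.filter fun e ↦ H.IsLoopAt e x : Finset β) := by
          ext e
          have : H.IsLoopAt e x → e ∈ F := fun he ↦ Finset.mem_coe.1 (hF ▸ he.edge_mem)
          simpa using this
        rw [degree, h1, h3, Set.encard_coe_eq_coe_finsetCard,
          Set.encard_coe_eq_coe_finsetCard] at h2
        exact_mod_cast h2
      have hr : ∀ e ∈ F, ((W.filter fun x ↦ H.Inc e x).card +
          (W.filter fun x ↦ H.IsLoopAt e x).card) = 2 := by
        intro e he
        obtain ⟨y, z, h⟩ := Graph.exists_isLink_of_mem_edgeSet (hF ▸ Finset.mem_coe.2 he)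
        have hy : y ∈ W := Finset.mem_coe.1 (hW ▸ h.left_mem)
        have hz : z ∈ W := Finset.mem_coe.1 (hW ▸ h.right_mem)
        rw [sum_ends h W, if_pos hy, if_pos hz]
      rw [Finset.sum_congr rfl hl, Finset.sum_congr rfl hr] at hsum
      simp at hsum
      omega
    have hEne : E(H).Nonempty := by
      obtain ⟨e, he, hex⟩ := hVH hx
      exact ⟨e, hcl.closed (edgeSubgraph_inc.2 ⟨he, hex⟩) hx⟩
    have hsub : ends G (Y \ E(H)) ⊆ ends G Y \ V(H) := by
      rintro y ⟨f, hf, hfy⟩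
      exact ⟨⟨f, hf.1, hfy⟩, fun hy ↦ hf.2 (hcl.closed (edgeSubgraph_inc.2 ⟨hf.1, hfy⟩) hy)⟩
    have h1 := hmin (Y \ E(H)) (by
      refine Set.sdiff_subset.ssubset_of_ne fun h ↦ ?_
      obtain ⟨e, he⟩ := hEne
      have he' : e ∈ Y \ E(H) := by rw [h]; exact hEH he
      exact he'.2 he)
    have h2 := Set.ncard_le_ncard hsub ((ends_finite G hfin).sdiff)
    have h3 := Set.ncard_sdiff_add_ncard_of_subset hVH (ends_finite G hfin)
    have h4 := Set.ncard_sdiff_add_ncard_of_subset hEH hfin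
    omega

/-- The component of a vertex. -/
lemma exists_component {G : Graph α β} {x : α} (hx : x ∈ V(G)) :
    ∃ H, IsComponent H G ∧ V(H) = {y | Relation.ReflTransGen G.Adj x y} := by
  have hsub : {y | Relation.ReflTransGen G.Adj x y} ⊆ V(G) := by
    intro y hy
    rcases Relation.ReflTransGen.cases_tail hy with rfl | ⟨z, -, h⟩
    exacts [hx, h.right_mem]
  have hstep : ∀ {y z}, (G.induce {y | Relation.ReflTransGen G.Adj x y}).Adj y z ↔
      Relation.ReflTransGen G.Adj x y ∧ G.Adj y z := by
    intro y z
    exact ⟨fun ⟨e, h⟩ ↦ ⟨h.2.1, e, h.1⟩, fun ⟨h, e, h'⟩ ↦ ⟨e, h', h, h.tail ⟨e, h'⟩⟩⟩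
  refine ⟨G.induce {y | Relation.ReflTransGen G.Adj x y}, ⟨?_, ⟨x, .refl⟩, ?_⟩, rfl⟩
  · refine Graph.IsClosedSubgraph.mk' (Graph.induce_le hsub) ?_
    rintro e y ⟨z, h⟩ hy
    exact ⟨y, z, h, hy, Relation.ReflTransGen.tail hy ⟨e, h⟩⟩
  · have key : ∀ y, Relation.ReflTransGen G.Adj x y →
        Relation.ReflTransGen (G.induce {y | Relation.ReflTransGen G.Adj x y}).Adj x y := by
      intro y hy
      induction hy with
      | refl => exact .refl
      | tail h1 h2 ih => exact ih.tail (hstep.2 ⟨h1, h2⟩)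
    intro y hy z hz
    refine Relation.ReflTransGen.trans ?_ (key z hz)
    exact Relation.ReflTransGen.stdSymm.symm _ _ (key y hy)

/-- Proper subsets of a member of `𝒞ₖ(G)` satisfy the strict count. -/
lemma IsKCircuit.count_lt {G : Graph α β} (hE : E(G).Finite) {k : ℕ} {C D : Set β}
    (hC : IsKCircuit G k C) (hD : D ⊂ C) : D.ncard < (ends G D).ncard + k := by
  obtain ⟨hCE, hex, hdeg0, hdeg1, hcomp⟩ := hC
  have hfin := hE.subset hCE
  rw [excess_edgeSubgraph hCE] at hex
  have hends := ends_mono (G := G) hD.subset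
  set W := ends G C \ ends G D
  have hcard1 : W.ncard + (ends G D).ncard = (ends G C).ncard := Set.ncard_sdiff_add_ncard_of_subset hends (ends_finite G hfin)
  have hcard2 := Set.ncard_sdiff_add_ncard_of_subset hD.subset hfin
  have hWF : ∀ x ∈ W, (edgeSubgraph G C).incidenceSet x ⊆ C \ D := by
    intro x hx e he
    have := edgeSubgraph_inc.1 he
    exact ⟨this.1, fun heD ↦ hx.2 ⟨e, heD, this.2⟩⟩
  have hne : (C \ D).Nonempty := Set.nonempty_of_ssubset hD
  have hpos : 0 < (C \ D).ncard := (Set.ncard_pos (hfin.sdiff)).2 hne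
  obtain ⟨hle, heq⟩ := degree_count (G := edgeSubgraph G C) (W := W) (F := C \ D)
    ((ends_finite G hfin).sdiff) hfin.sdiff (fun e he ↦ ⟨hCE he.1, he.1⟩) hWF (by
      intro x hx
      have h0 := hdeg0 x hx.1
      have h1 := hdeg1 x hx.1
      by_contra h
      have h' := Order.le_of_lt_add_one
        (show degree (edgeSubgraph G C) x < 1 + 1 by rw [one_add_one_eq_two]; exact not_le.1 h)
      have h'' := lt_of_le_of_ne h' h1
      rw [Order.lt_one_iff] at h''
      exact h0 h'')
  by_contra hcon
  obtain ⟨hd2, hin⟩ := heq (by omega)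
  obtain ⟨e, he⟩ := hne
  obtain ⟨x, y, hxy⟩ := Graph.exists_isLink_of_mem_edgeSet (hCE he.1)
  have hxW : x ∈ W := hin e he x (edgeSubgraph_inc.2 ⟨he.1, hxy.inc_left⟩)
  obtain ⟨H, hH, hHV⟩ := exists_component (G := edgeSubgraph G C) (x := x) hxW.1
  have hVW : ∀ z, Relation.ReflTransGen (edgeSubgraph G C).Adj x z → z ∈ W := by
    intro z hz
    induction hz with
    | refl => exact hxW
    | tail _ h ih =>
      obtain ⟨f, hf⟩ := h
      exact hin f (hWF _ ih hf.inc_left) _ hf.inc_right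
  refine hcomp H hH ⟨hH.2, fun z hz ↦ ?_⟩
  rw [closed_degree hH.1 hz]
  exact hd2 z (hVW z (by rw [hHV] at hz; exact hz))

lemma IsKCircuit.count_le {G : Graph α β} {k : ℕ} {C : Set β}
    (hC : IsKCircuit G k C) : (ends G C).ncard + k ≤ C.ncard := by
  have := hC.2.1
  rw [excess_edgeSubgraph hC.1] at this
  omega

/-- A set of edges contains no member of `𝒞ₖ(G)` exactly if `|Y| < |V(G⟨Y⟩)| + k` for all its
subsets `Y`. -/
lemma forall_not_isKCircuit_iff {G : Graph α β} (hE : E(G).Finite) {k : ℕ} (hk : 1 ≤ k)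
    {I : Set β} (hI : I ⊆ E(G)) :
    (∀ C ⊆ I, ¬ IsKCircuit G k C) ↔ ∀ Y ⊆ I, Y.ncard < (ends G Y).ncard + k := by
  refine ⟨fun h Y hY ↦ ?_, fun h C hC hCk ↦ (h C hC).not_ge hCk.count_le⟩
  by_contra hcon
  have hfin : {Z | Z ⊆ Y ∧ (ends G Z).ncard + k ≤ Z.ncard}.Finite :=
    (hE.subset (hY.trans hI)).finite_subsets.subset fun Z hZ ↦ hZ.1
  obtain ⟨Z, hZ⟩ := hfin.exists_minimal ⟨Y, subset_rfl, not_lt.1 hcon⟩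
  refine h Z (hZ.prop.1.trans hY) (isKCircuit_of_minimal hE hk (hZ.prop.1.trans (hY.trans hI))
    hZ.prop.2 fun T hT ↦ ?_)
  by_contra hT'
  exact hT.not_subset (hZ.le_of_le ⟨hT.subset.trans hZ.prop.1, not_lt.1 hT'⟩ hT.subset)

lemma count_aug {G : Graph α β} (hE : E(G).Finite) {k : ℕ} {I J : Set β}
    (hIE : I ⊆ E(G)) (hJE : J ⊆ E(G)) (hI : ∀ Y ⊆ I, Y.ncard < (ends G Y).ncard + k)
    (hJ : ∀ Y ⊆ J, Y.ncard < (ends G Y).ncard + k) (hIJ : I.ncard < J.ncard) :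
    ∃ e ∈ J, e ∉ I ∧ ∀ Y ⊆ insert e I, Y.ncard < (ends G Y).ncard + k := by
  by_contra! hcon
  have hIf := hE.subset hIE
  have hJf := hE.subset hJE
  have hfe : ∀ {X}, X ⊆ I → (ends G X).Finite := fun h ↦ ends_finite G (hIf.subset h)
  -- every edge in `J \ I` is spanned by a tight subset of `I`
  have htight : ∀ e ∈ J \ I, ∃ X ⊆ I, X.ncard + 1 = (ends G X).ncard + k ∧
      ends G {e} ⊆ ends G X := by
    rintro e ⟨heJ, heI⟩
    obtain ⟨Y, hYI, hY⟩ := hcon e heJ heI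
    have hYf : Y.Finite := (hIf.insert e).subset hYI
    have heY : e ∈ Y := by
      by_contra heY
      exact (hI Y ((Set.subset_insert_iff_of_notMem heY).1 hYI)).not_ge hY
    have hXI : Y \ {e} ⊆ I := by
      rintro f ⟨hf, hfe⟩
      exact (hYI hf).resolve_left hfe
    have h1 := Set.ncard_sdiff_singleton_add_one heY hYf
    have h2 := hI _ hXI
    have h3 := ends_mono (G := G) (Set.sdiff_subset (s := Y) (t := {e}))
    have h4 := Set.ncard_le_ncard h3 (ends_finite G hYf)
    refine ⟨Y \ {e}, hXI, by omega, ?_⟩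
    rw [Set.eq_of_subset_of_ncard_le h3 (by omega) (ends_finite G hYf)]
    exact ends_mono (by simpa using heY)
  obtain ⟨e₀, he₀⟩ : (J \ I).Nonempty := by
    rw [Set.nonempty_iff_ne_empty, Ne, Set.sdiff_eq_empty]
    exact fun h ↦ (Set.ncard_le_ncard h hIf).not_gt hIJ
  obtain ⟨X₀, hX₀I, hX₀, -⟩ := htight e₀ he₀
  have hfin : {X | X ⊆ I ∧ X.ncard + 1 = (ends G X).ncard + k}.Finite :=
    hIf.finite_subsets.subset fun X hX ↦ hX.1
  obtain ⟨T, hT⟩ := hfin.exists_maximal ⟨X₀, hX₀I, hX₀⟩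
  obtain ⟨hTI, hTt⟩ := hT.prop
  have hmax : ∀ X ⊆ I, X.ncard + 1 = (ends G X).ncard + k → X ⊆ T := by
    intro X hX hXt
    have hU : T ∪ X ⊆ I := Set.union_subset hTI hX
    have h1 := Set.ncard_union_add_ncard_inter T X (hIf.subset hTI) (hIf.subset hX)
    have h2 := Set.ncard_union_add_ncard_inter (ends G T) (ends G X) (hfe hTI) (hfe hX)
    rw [← ends_union] at h2
    have h3 : ends G (T ∩ X) ⊆ ends G T ∩ ends G X :=
      Set.subset_inter (ends_mono Set.inter_subset_left) (ends_mono Set.inter_subset_right)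
    have h4 := Set.ncard_le_ncard h3 ((hfe hTI).inter_of_left _)
    have h5 := hI (T ∩ X) (Set.inter_subset_left.trans hTI)
    have h6 := hI _ hU
    have := hT.le_of_ge ⟨hU, by omega⟩ Set.subset_union_left
    exact Set.subset_union_right.trans this
  have hsub : ends G ((J ∩ T) ∪ (J \ I)) ⊆ ends G T := by
    rintro x ⟨e, he | he, hex⟩
    · exact ⟨e, he.2, hex⟩
    · obtain ⟨X, hXI, hXt, hXe⟩ := htight e he
      exact ends_mono (hmax X hXI hXt) (hXe ⟨e, rfl, hex⟩)
  have h1 := hJ ((J ∩ T) ∪ (J \ I)) (Set.union_subset Set.inter_subset_left Set.sdiff_subset)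
  have h2 := Set.ncard_le_ncard hsub (hfe hTI)
  have h3 : J ⊆ ((J ∩ T) ∪ (J \ I)) ∪ (I \ T) := by
    intro e he
    simp only [Set.mem_union, Set.mem_inter_iff, Set.mem_sdiff]
    tauto
  have h4 := Set.ncard_le_ncard h3
    (((hJf.inter_of_left _).union hJf.sdiff).union hIf.sdiff)
  have h5 := Set.ncard_union_le ((J ∩ T) ∪ (J \ I)) (I \ T)
  have h6 := Set.ncard_sdiff_add_ncard_of_subset hTI hIf
  omega

/-- The `k`-circular matroid `Mₖ(G)` of a graph `G` with finitely many edges, for `k ≥ 1`: a set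
of edges is independent if it contains no member of `𝒞ₖ(G)`. -/
noncomputable def kCircularMatroid (G : Graph α β) (hE : E(G).Finite) (k : ℕ) (hk : 1 ≤ k) :
    Matroid β :=
  (IndepMatroid.ofFinite hE (fun I ↦ I ⊆ E(G) ∧ ∀ C ⊆ I, ¬ IsKCircuit G k C)
    ⟨Set.empty_subset _, by
      rw [forall_not_isKCircuit_iff hE hk (Set.empty_subset _)]
      intro Y hY
      rw [Set.subset_empty_iff.1 hY, Set.ncard_empty]
      omega⟩
    (fun _ _ hJ hIJ ↦ ⟨hIJ.trans hJ.1, fun C hC ↦ hJ.2 C (hC.trans hIJ)⟩)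
    (fun I J hI hJ hIJ ↦ by
      obtain ⟨e, heJ, heI, h⟩ := count_aug hE hI.1 hJ.1
        ((forall_not_isKCircuit_iff hE hk hI.1).1 hI.2)
        ((forall_not_isKCircuit_iff hE hk hJ.1).1 hJ.2) hIJ
      have hsub : insert e I ⊆ E(G) := Set.insert_subset (hJ.1 heJ) hI.1
      exact ⟨e, heJ, heI, hsub, (forall_not_isKCircuit_iff hE hk hsub).2 h⟩)
    (fun _ hI ↦ hI.1)).matroid

lemma kCircularMatroid_ground (G : Graph α β) (hE : E(G).Finite) (k : ℕ) (hk : 1 ≤ k) :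
    (kCircularMatroid G hE k hk).E = E(G) := rfl

lemma kCircularMatroid_indep_iff (G : Graph α β) (hE : E(G).Finite) (k : ℕ) (hk : 1 ≤ k)
    (I : Set β) : (kCircularMatroid G hE k hk).Indep I ↔
      I ⊆ E(G) ∧ ∀ C ⊆ I, ¬ IsKCircuit G k C := Iff.rfl

/-- The circuits of `Mₖ(G)` are exactly the members of `𝒞ₖ(G)`. -/
theorem kCircularMatroid_isCircuit_iff (G : Graph α β) (hE : E(G).Finite) (k : ℕ) (hk : 1 ≤ k)
    (C : Set β) : (kCircularMatroid G hE k hk).IsCircuit C ↔ IsKCircuit G k C := by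
  rw [Matroid.isCircuit_iff_forall_ssubset, Matroid.dep_iff]
  simp only [kCircularMatroid_indep_iff, kCircularMatroid_ground]
  constructor
  · rintro ⟨⟨h1, hCE⟩, h2⟩
    have : ∃ D ⊆ C, IsKCircuit G k D := by
      by_contra! hcon
      exact h1 ⟨hCE, hcon⟩
    obtain ⟨D, hDC, hD⟩ := this
    rcases hDC.eq_or_ssubset with rfl | hss
    · exact hD
    · exact absurd hD ((h2 hss).2 D subset_rfl)
  · intro hC
    refine ⟨⟨fun h ↦ h.2 C subset_rfl hC, hC.1⟩, fun I hI ↦ ⟨hI.subset.trans hC.1, ?_⟩⟩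
    intro D hD hDk
    exact (hC.count_lt hE (hD.trans_ssubset hI)).not_ge hDk.count_le

/-! ### Non-separating cocircuits and small vertex stars -/

/-- A matroid is connected if it has no loops and no coloops and every two of its elements belong
to a common circuit. -/
def MatroidConnected (M : Matroid β) : Prop :=
  (∀ e ∈ M.E, ¬ M.IsLoop e) ∧ (∀ e ∈ M.E, ¬ M.IsColoop e) ∧
    ∀ e ∈ M.E, ∀ f ∈ M.E, ∃ C, M.IsCircuit C ∧ e ∈ C ∧ f ∈ C

/-- A non-separating cocircuit of a connected matroid `M` is a cocircuit `K` such that `M ＼ K` is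
connected. -/
def IsNonseparatingCocircuit (M : Matroid β) (K : Set β) : Prop :=
  MatroidConnected M ∧ M.IsCocircuit K ∧ MatroidConnected (M ＼ K)

/-- `S` is a vertex star of `G`: the set of all edges incident to some vertex of `G`. -/
def IsVertexStar (G : Graph α β) (S : Set β) : Prop :=
  ∃ x ∈ V(G), S = G.incidenceSet x

end KCircular

/-! Write V(Y) for `ends G Y`. Independence in `Mₖ(G)` is a counting condition: |Y| ≤ |V(Y)| + k - 1
for all Y ⊆ I. Subsets attaining the bound are tight; since |V(·)| is submodular, the tight subsets
of an independent set are closed under union and intersection. A circuit minus an edge is tight, so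
uncrossing fundamental circuits shows that F has rank |V(F)| + k - 1 if it is connected with |F| ≥
|V(F)| + k (`tight_of_isBasis`) or a nonempty union of circuits
(`ncard_of_isBasis_of_forall_mem_circuit`). In particular `Mₖ(G)` has rank |V| + k - 1, and a star
of a vertex x has size at most the corank exactly when G - x has excess at least k.

If K is a non-separating cocircuit, its complement is a hyperplane and a union of circuits.
Comparing ranks, the complement misses some vertex x, so K contains the star of x. This star meets
every base, hence equals K by minimality. The complement is dependent, which gives the bound on |K|.

Conversely, if the star of x is small enough, G - x is connected with minimum degree at least two
and excess at least k. Its rank is one below full and any edge at x restores it, so the star is a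
cocircuit. That the deletion is connected is `exists_isKCircuit_mem_mem`. For k = 1 a degree count
excludes separators (`exists_circuit_crossing`); then k is raised step by step, because a circuit at
level i is tight at level i + 1 and extends to a circuit there (`IsKCircuit.exists_superset`). -/

namespace KCircular

variable {α β : Type*}

/-! ### Transitivity of the common-circuit relation -/

/-- Being in a common circuit is a transitive relation on the elements of a finite matroid. -/
lemma exists_isCircuit_trans {M : Matroid β} [M.Finite] {C₁ C₂ : Set β} (h₁ : M.IsCircuit C₁)
    (h₂ : M.IsCircuit C₂) (hne : (C₁ ∩ C₂).Nonempty) {e f : β} (he : e ∈ C₁) (hf : f ∈ C₂) :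
    ∃ C ⊆ C₁ ∪ C₂, M.IsCircuit C ∧ e ∈ C ∧ f ∈ C := by
  induction hn : (C₁ ∪ C₂).ncard using Nat.strong_induction_on generalizing C₁ C₂ with
  | _ n ih =>
    by_cases heC : e ∈ C₂
    · exact ⟨C₂, Set.subset_union_right, h₂, heC, hf⟩
    by_cases hfC : f ∈ C₁
    · exact ⟨C₁, Set.subset_union_left, h₁, he, hfC⟩
    have hfin : (C₁ ∪ C₂).Finite :=
      M.ground_finite.subset (Set.union_subset h₁.subset_ground h₂.subset_ground)
    have hlt : ∀ {X : Set β} {x : β}, X ⊆ C₁ ∪ C₂ → x ∈ C₁ ∪ C₂ → x ∉ X → X.ncard < n :=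
      fun hX hx hxX ↦ hn ▸ Set.ncard_lt_ncard ⟨hX, fun h ↦ hxX (h hx)⟩ hfin
    obtain ⟨g, hg₁, hg₂⟩ := hne
    obtain ⟨C₃, h₃s, h₃, heC₃⟩ := h₁.strong_elimination h₂ hg₁ hg₂ he heC
    obtain ⟨C₄, h₄s, h₄, hfC₄⟩ := h₂.strong_elimination h₁ hg₂ hg₁ hf hfC
    rw [Set.union_comm C₂] at h₄s
    have h₃s' := h₃s.trans Set.sdiff_subset
    have h₄s' := h₄s.trans Set.sdiff_subset
    have hgC₃ : g ∉ C₃ := fun h ↦ (h₃s h).2 rfl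
    have hgC₄ : g ∉ C₄ := fun h ↦ (h₄s h).2 rfl
    -- The induction applies to `C₃`, `C₄` if both contain y, as their union misses g. Otherwise it
    -- applies to `C₁`, `C₄`, which share z and whose union misses y.
    obtain ⟨y, hyC₃, hyC₁⟩ : ∃ y ∈ C₃, y ∉ C₁ := by
      by_contra! h
      exact hgC₃ (h₃.eq_of_subset_isCircuit h₁ h ▸ hg₁)
    have hyC₂ : y ∈ C₂ := (h₃s' hyC₃).resolve_left hyC₁
    obtain ⟨z, hzC₄, hzC₂⟩ : ∃ z ∈ C₄, z ∉ C₂ := by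
      by_contra! h
      exact hgC₄ (h₄.eq_of_subset_isCircuit h₂ h ▸ hg₂)
    have hzC₁ : z ∈ C₁ := (h₄s' hzC₄).resolve_right hzC₂
    have mono : ∀ {D₁ D₂ : Set β}, D₁ ∪ D₂ ⊆ C₁ ∪ C₂ →
        (∃ C ⊆ D₁ ∪ D₂, M.IsCircuit C ∧ e ∈ C ∧ f ∈ C) →
        ∃ C ⊆ C₁ ∪ C₂, M.IsCircuit C ∧ e ∈ C ∧ f ∈ C :=
      fun h ⟨C, hC, h'⟩ ↦ ⟨C, hC.trans h, h'⟩
    by_cases hyC₄ : y ∈ C₄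
    · have hs := Set.union_subset h₃s' h₄s'
      exact mono hs (ih _ (hlt hs (.inl hg₁) (by simp [hgC₃, hgC₄])) h₃ h₄ ⟨y, hyC₃, hyC₄⟩
        heC₃ hfC₄ rfl)
    · have hs := Set.union_subset (Set.subset_union_left (s := C₁) (t := C₂)) h₄s'
      exact mono hs (ih _ (hlt hs (.inr hyC₂) (by simp [hyC₁, hyC₄])) h₁ h₄ ⟨z, hzC₁, hzC₄⟩
        he hfC₄ rfl)

/-- A connected graph has no proper nonempty set of vertices closed under adjacency. -/
lemma Connected.subset_of_closed {H : Graph α β} (hH : Connected H) {W : Set α} {x : α}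
    (hx : x ∈ V(H)) (hxW : x ∈ W) (hW : ∀ y z, H.Adj y z → y ∈ W → z ∈ W) : V(H) ⊆ W := by
  intro y hy
  induction hH.2 x hx y hy with
  | refl => exact hxW
  | tail h₁ h₂ ih => exact hW _ _ h₂ (ih h₂.left_mem)

/-! ### Tight sets of edges -/

/-- `X` is a tight set of edges: it meets the bound on the size of independent sets of `Mₖ(G)`. -/
def Tight (G : Graph α β) (k : ℕ) (X : Set β) : Prop :=
  X.ncard + 1 = (ends G X).ncard + k

lemma indep_iff_count {G : Graph α β} (hE : E(G).Finite) {k : ℕ} (hk : 1 ≤ k) {I : Set β} :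
    (kCircularMatroid G hE k hk).Indep I ↔
      I ⊆ E(G) ∧ ∀ Y ⊆ I, Y.ncard < (ends G Y).ncard + k := by
  rw [kCircularMatroid_indep_iff]
  exact and_congr_right fun h ↦ forall_not_isKCircuit_iff hE hk h

/-- |Z| - |V(Z)| is supermodular and at most k - 1 on all subsets of I, the empty one included. Its
values at X and Y are both maximal, so those at the union and the intersection are too. -/
lemma Tight.union_inter {G : Graph α β} {k : ℕ} {I X Y : Set β} (hIf : I.Finite)
    (hI : ∀ Y ⊆ I, Y.ncard < (ends G Y).ncard + k) (hX : Tight G k X) (hY : Tight G k Y)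
    (hXI : X ⊆ I) (hYI : Y ⊆ I) : Tight G k (X ∪ Y) ∧ Tight G k (X ∩ Y) := by
  have hfe : ∀ {Z}, Z ⊆ I → (ends G Z).Finite := fun h ↦ ends_finite G (hIf.subset h)
  have h1 := Set.ncard_union_add_ncard_inter X Y (hIf.subset hXI) (hIf.subset hYI)
  have h2 := Set.ncard_union_add_ncard_inter (ends G X) (ends G Y) (hfe hXI) (hfe hYI)
  rw [← ends_union] at h2
  have h4 := Set.ncard_le_ncard (Set.subset_inter (ends_mono (G := G) Set.inter_subset_left)
    (ends_mono Set.inter_subset_right) : ends G (X ∩ Y) ⊆ ends G X ∩ ends G Y)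
    ((hfe hXI).inter_of_left _)
  have h5 := hI _ (Set.inter_subset_left.trans hXI : X ∩ Y ⊆ I)
  have h6 := hI _ (Set.union_subset hXI hYI)
  unfold Tight at *
  omega

/-- If an independent set has a tight subset, then it has a largest one. -/
lemma exists_greatest_tight {G : Graph α β} {k : ℕ} {I X : Set β} (hIf : I.Finite)
    (hI : ∀ Y ⊆ I, Y.ncard < (ends G Y).ncard + k) (hX : Tight G k X) (hXI : X ⊆ I) :
    ∃ T ⊆ I, Tight G k T ∧ ∀ Y ⊆ I, Tight G k Y → Y ⊆ T := by
  have hfin : {X | X ⊆ I ∧ Tight G k X}.Finite := hIf.finite_subsets.subset fun X hX ↦ hX.1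
  obtain ⟨T, hT⟩ := hfin.exists_maximal ⟨X, hXI, hX⟩
  refine ⟨T, hT.prop.1, hT.prop.2, fun Y hY hYt ↦ ?_⟩
  exact Set.subset_union_right.trans (hT.le_of_ge ⟨Set.union_subset hT.prop.1 hY,
    (hT.prop.2.union_inter hIf hI hYt hT.prop.1 hY).1⟩ Set.subset_union_left)

/-- Removing an edge from a circuit leaves a tight set which spans the ends of this edge. -/
lemma IsKCircuit.tight_sdiff {G : Graph α β} (hE : E(G).Finite) {k : ℕ} {C : Set β}
    (hC : IsKCircuit G k C) {g : β} (hg : g ∈ C) :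
    Tight G k (C \ {g}) ∧ ends G (C \ {g}) = ends G C := by
  have hfin := hE.subset hC.1
  have h1 := hC.count_lt hE (Set.sdiff_singleton_ssubset.2 hg)
  have h2 := hC.count_le
  have h3 := Set.ncard_sdiff_singleton_add_one hg hfin
  have h4 := ends_mono (G := G) (Set.sdiff_subset (s := C) (t := {g}))
  have h5 := Set.ncard_le_ncard h4 (ends_finite G hfin)
  exact ⟨by unfold Tight; omega, Set.eq_of_subset_of_ncard_le h4 (by omega) (ends_finite G hfin)⟩

lemma exists_circuit_of_isBasis {G : Graph α β} {hE : E(G).Finite} {k : ℕ} {hk : 1 ≤ k}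
    {F I : Set β} (hI : (kCircularMatroid G hE k hk).IsBasis I F) {g : β} (hgF : g ∈ F)
    (hgI : g ∉ I) : ∃ C ⊆ insert g I, IsKCircuit G k C ∧ g ∈ C := by
  have h := hI.insert_dep ⟨hgF, hgI⟩
  obtain ⟨C, hC, hCc⟩ := h.exists_isCircuit_subset
  refine ⟨C, hC, (kCircularMatroid_isCircuit_iff ..).1 hCc, ?_⟩
  by_contra hg
  exact hCc.not_indep (hI.indep.subset ((Set.subset_insert_iff_of_notMem hg).1 hC))

/-- A basis of a set of edges with enough edges that forms a connected graph is tight. -/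
lemma tight_of_isBasis {G : Graph α β} {hE : E(G).Finite} {k : ℕ} {hk : 1 ≤ k} {F I : Set β}
    (hF : Connected (edgeSubgraph G F)) (hcard : (ends G F).ncard + k ≤ F.ncard)
    (hI : (kCircularMatroid G hE k hk).IsBasis I F) :
    Tight G k I ∧ ends G I = ends G F := by
  have hFE : F ⊆ E(G) := hI.subset_ground
  have hFf := hE.subset hFE
  have hIF := hI.subset
  have hIf := hFf.subset hIF
  have hIc := ((indep_iff_count hE hk).1 hI.indep).2
  obtain ⟨g, hgF, hgI⟩ : ∃ g ∈ F, g ∉ I := by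
    by_contra! h
    exact (((indep_iff_count hE hk).1 (hI.indep.subset h)).2 F subset_rfl).not_ge hcard
  have key : ∀ g ∈ F, g ∉ I → ∃ X ⊆ I, Tight G k X ∧ ends G {g} ⊆ ends G X := by
    intro g hgF hgI
    obtain ⟨C, hCI, hC, hgC⟩ := exists_circuit_of_isBasis hI hgF hgI
    obtain ⟨h1, h2⟩ := hC.tight_sdiff hE hgC
    exact ⟨C \ {g}, by simpa using hCI, h1, h2 ▸ ends_mono (by simpa using hgC)⟩
  obtain ⟨X, hXI, hX, hgX⟩ := key g hgF hgI
  obtain ⟨T, hTI, hT, hTmax⟩ := exists_greatest_tight hIf hIc hX hXI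
  obtain ⟨x, y, hxy⟩ := Graph.exists_isLink_of_mem_edgeSet (hFE hgF)
  -- V(T) is closed under adjacency in F. Edges outside I are spanned by tight sets, hence by T; an
  -- edge of I leaving V(T) would add one edge and one vertex to T, giving a larger tight set.
  have hsub : ends G F ⊆ ends G T := by
    refine hF.subset_of_closed (x := x) ⟨g, hgF, hxy.inc_left⟩
      (ends_mono (hTmax X hXI hX) (hgX ⟨g, rfl, hxy.inc_left⟩)) ?_
    rintro y z ⟨f, hfF, hf⟩ hy
    by_cases hfT : f ∈ T
    · exact ⟨f, hfT, hf.inc_right⟩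
    by_cases hfI : f ∈ I
    · by_contra hz
      refine hfT (hTmax (insert f T) (Set.insert_subset hfI hTI) ?_ (Set.mem_insert f T))
      have h1 := Set.ncard_insert_of_notMem hfT (hIf.subset hTI)
      have h2 := hIc (insert f T) (Set.insert_subset hfI hTI)
      have h3 : ends G (insert f T) ⊆ insert z (ends G T) := by
        rintro w ⟨e, rfl | he, hw⟩
        · rcases hw.eq_or_eq_of_isLink hf with rfl | rfl
          exacts [.inr hy, .inl rfl]
        · exact .inr ⟨e, he, hw⟩
      have h4 := Set.ncard_le_ncard h3 ((ends_finite G (hIf.subset hTI)).insert z)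
      have h5 := Set.ncard_insert_of_notMem hz (ends_finite G (hIf.subset hTI))
      unfold Tight at *
      omega
    · obtain ⟨X, hXI, hX, hgX⟩ := key f hfF hfI
      exact ends_mono (hTmax X hXI hX) (hgX ⟨f, rfl, hf.inc_right⟩)
  have h1 := Set.ncard_le_ncard hTI hIf
  have h2 := hIc I subset_rfl
  have h3 := ends_mono (G := G) hTI
  have h4 := ends_mono (G := G) hIF
  have h5 := Set.ncard_le_ncard (h4.trans hsub) (ends_finite G (hIf.subset hTI))
  have h6 := Set.ncard_le_ncard h3 (ends_finite G hIf)
  exact ⟨by unfold Tight at *; omega, h4.antisymm (hsub.trans h3)⟩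

/-! ### Circuits through two prescribed edges -/

/-- Every member of `𝒞ᵢ(G)` inside a set of edges of excess larger than `i` extends to a member
of `𝒞ᵢ₊₁(G)` inside this set. -/
lemma IsKCircuit.exists_superset {G : Graph α β} (hE : E(G).Finite) {i : ℕ}
    {D F : Set β} (hD : IsKCircuit G i D) (hDF : D ⊆ F) (hFE : F ⊆ E(G))
    (hcard : (ends G F).ncard + (i + 1) ≤ F.ncard) :
    ∃ C ⊆ F, IsKCircuit G (i + 1) C ∧ D ⊆ C := by
  -- The excess i of D is the largest value that independence at level i + 1 allows, so D is
  -- independent and tight there.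
  have hDi : (kCircularMatroid G hE (i + 1) (by omega)).Indep D := by
    refine (indep_iff_count hE _).2 ⟨hD.1, fun Y hY ↦ ?_⟩
    rcases hY.eq_or_ssubset with rfl | hY
    · have := hD.2.1
      rw [excess_edgeSubgraph hD.1] at this
      omega
    · have := hD.count_lt hE hY
      omega
  obtain ⟨I, hI, hDI⟩ := hDi.subset_isBasis_of_subset hDF hFE
  obtain ⟨g, hgF, hgI⟩ : ∃ g ∈ F, g ∉ I := by
    by_contra! h
    exact (((indep_iff_count hE _).1 (hI.indep.subset h)).2 F subset_rfl).not_ge hcard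
  obtain ⟨C, hCI, hC, hgC⟩ := exists_circuit_of_isBasis hI hgF hgI
  refine ⟨C, hCI.trans (Set.insert_subset hgF hI.subset), hC, ?_⟩
  have hDt : Tight G (i + 1) D := by
    have := hD.2.1
    rw [excess_edgeSubgraph hD.1] at this
    unfold Tight
    omega
  -- The intersection of D with the fundamental circuit is tight at level i + 1, whereas proper
  -- subsets of D have excess below i. Hence it is all of D.
  have h := (hDt.union_inter (hE.subset hI.indep.subset_ground)
    ((indep_iff_count hE _).1 hI.indep).2 (hC.tight_sdiff hE hgC).1 hDI (by simpa using hCI)).2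
  by_contra hDC
  have h' := hD.count_lt hE (D := D ∩ (C \ {g})) ⟨Set.inter_subset_left,
    fun hs ↦ hDC fun x hx ↦ (hs hx).2.1⟩
  unfold Tight at h
  omega

/-- If the edges of `F` outside `R` have their ends in `W`, there are at most as many edges in `R`
as there are vertices outside `W`, and all degrees are at least two, then the edges in `R` avoid
`W`. -/
lemma ends_subset_sdiff {G : Graph α β} (hE : E(G).Finite) {F R : Set β} {W : Set α}
    (hFE : F ⊆ E(G)) (hRF : R ⊆ F) (hdeg : ∀ x ∈ ends G F, 2 ≤ degree (edgeSubgraph G F) x)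
    (hW : ∀ e ∈ F, e ∉ R → ends G {e} ⊆ W) (hcard : R.ncard ≤ (ends G F \ W).ncard) :
    R.ncard = (ends G F \ W).ncard ∧ ends G R ⊆ ends G F \ W := by
  have hfin := hE.subset hFE
  -- All edges at vertices outside W lie in R. Degrees of at least two force at least as many such
  -- edges as vertices; equality leaves no edge of R with an end in W.
  obtain ⟨h1, h2⟩ := degree_count (G := edgeSubgraph G F) (W := ends G F \ W) (F := R)
    (ends_finite G hfin).sdiff (hfin.subset hRF) (fun e he ↦ ⟨hFE (hRF he), hRF he⟩)
    (fun x hx e he ↦ by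
      have he := edgeSubgraph_inc.1 he
      by_contra heR
      exact hx.2 (hW e he.1 heR ⟨e, rfl, he.2⟩))
    (fun x hx ↦ hdeg x hx.1)
  refine ⟨by omega, ?_⟩
  rintro x ⟨e, he, hx⟩
  exact (h2 (by omega)).2 e he x (edgeSubgraph_inc.2 ⟨hRF he, hx⟩)

lemma ends_empty (G : Graph α β) : ends G ∅ = ∅ := by
  ext x
  simp [ends]

/-- The bicircular matroid of a connected graph of minimum degree two that is not a cycle has no
separators. -/
lemma exists_circuit_crossing {G : Graph α β} (hE : E(G).Finite) {F A : Set β} (hFE : F ⊆ E(G))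
    (hF : Connected (edgeSubgraph G F))
    (hdeg : ∀ x ∈ ends G F, 2 ≤ degree (edgeSubgraph G F) x)
    (hcard : (ends G F).ncard + 1 ≤ F.ncard) (hA : (F ∩ A).Nonempty) (hA' : (F \ A).Nonempty) :
    ∃ C ⊆ F, IsKCircuit G 1 C ∧ (C ∩ A).Nonempty ∧ (C \ A).Nonempty := by
  by_contra! hcon
  have hFf := hE.subset hFE
  obtain ⟨I, hI⟩ := (kCircularMatroid G hE 1 le_rfl).exists_isBasis F hFE
  have hIF := hI.subset
  have hIf := hFf.subset hIF
  have hIc := ((indep_iff_count hE le_rfl).1 hI.indep).2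
  -- For k = 1 the empty set is tight, so both sides of the separation have a greatest tight subset
  -- of the basis, possibly empty.
  have hempty : Tight G 1 ∅ := by simp [Tight, ends_empty]
  have hIc' : ∀ {J}, J ⊆ I → ∀ Y ⊆ J, Y.ncard < (ends G Y).ncard + 1 :=
    fun hJ Y hY ↦ hIc Y (hY.trans hJ)
  obtain ⟨T, hTI, hT, hTmax⟩ := exists_greatest_tight (hIf.subset Set.inter_subset_left)
    (hIc' (Set.inter_subset_left (t := A))) hempty (Set.empty_subset _)
  obtain ⟨T', hTI', hT', hTmax'⟩ := exists_greatest_tight (hIf.subset Set.sdiff_subset)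
    (hIc' (Set.sdiff_subset (t := A))) hempty (Set.empty_subset _)
  have hTI₁ := hTI.trans Set.inter_subset_left
  have hTI₁' := hTI'.trans Set.sdiff_subset
  -- No circuit crosses A, so the fundamental circuit of g stays on the side of g, and the greatest
  -- tight set there spans g.
  have key : ∀ g ∈ F, g ∉ I → (g ∈ A → ends G {g} ⊆ ends G T) ∧
      (g ∉ A → ends G {g} ⊆ ends G T') := by
    intro g hgF hgI
    obtain ⟨C, hCI, hC, hgC⟩ := exists_circuit_of_isBasis hI hgF hgI
    have hCF := hCI.trans (Set.insert_subset hgF hIF)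
    obtain ⟨h1, h2⟩ := hC.tight_sdiff hE hgC
    have h3 : ends G {g} ⊆ ends G (C \ {g}) := h2 ▸ ends_mono (by simpa using hgC)
    have h4 : C \ {g} ⊆ I := by simpa using hCI
    refine ⟨fun hgA ↦ h3.trans (ends_mono (hTmax _ ?_ h1)),
      fun hgA ↦ h3.trans (ends_mono (hTmax' _ ?_ h1))⟩
    · refine Set.subset_inter h4 fun x hx ↦ ?_
      by_contra hxA
      exact (hcon C hCF hC ⟨g, hgC, hgA⟩).le ⟨hx.1, hxA⟩
    · refine Set.subset_sdiff.2 ⟨h4, Set.disjoint_left.2 fun x hx hxA ↦ ?_⟩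
      exact (hcon C hCF hC ⟨x, hx.1, hxA⟩).le ⟨hgC, hgA⟩
  have hTf := hIf.subset hTI₁
  have hTf' := hIf.subset hTI₁'
  have hdisjT : Disjoint T T' := Set.disjoint_left.2 fun x hx hx' ↦ (hTI' hx').2 (hTI hx).2
  have hU : T ∪ T' ⊆ I := Set.union_subset hTI₁ hTI₁'
  have hc1 := Set.ncard_union_eq hdisjT hTf hTf'
  have hc2 := hIc _ hU
  have hc3 := Set.ncard_union_add_ncard_inter (ends G T) (ends G T') (ends_finite G hTf)
    (ends_finite G hTf')
  rw [← ends_union] at hc3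
  have hc4 := Set.ncard_sdiff_add_ncard_of_subset hU hIf
  have hWF := ends_mono (G := G) (hU.trans hIF)
  have hc5 := Set.ncard_sdiff_add_ncard_of_subset hWF (ends_finite G hFf)
  have hc6 := hIc I subset_rfl
  have hc7 := Set.ncard_le_ncard (ends_mono (G := G) hIF) (ends_finite G hFf)
  unfold Tight at hT hT'
  -- |T| = |V(T)| and |T'| = |V(T')|, while independence of the union gives |T| + |T'| ≤ |V(T ∪
  -- T')|: a common vertex would violate this.
  have hdisj : Disjoint (ends G T) (ends G T') := by
    rw [Set.disjoint_iff_inter_eq_empty, ← Set.ncard_eq_zero ((ends_finite G hTf).inter_of_left _)]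
    omega
  have hR := (ends_subset_sdiff hE (R := I \ (T ∪ T')) (W := ends G (T ∪ T')) hFE
    (Set.sdiff_subset.trans hIF) hdeg (fun e heF heR ↦ by
      by_cases heI : e ∈ I
      · have : e ∈ T ∪ T' := by
          by_contra h
          exact heR ⟨heI, h⟩
        exact ends_mono (by simpa using this)
      · rw [ends_union]
        by_cases heA : e ∈ A
        exacts [((key e heF heI).1 heA).trans Set.subset_union_left,
          ((key e heF heI).2 heA).trans Set.subset_union_right]) (by omega)).2
  -- every edge has its ends in one of three disjoint sets of vertices
  have htri : ∀ e ∈ F, (ends G {e} ⊆ ends G T ∧ (e ∈ A ∨ e ∈ I)) ∨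
      (ends G {e} ⊆ ends G T' ∧ (e ∉ A ∨ e ∈ I)) ∨
      (ends G {e} ⊆ ends G F \ ends G (T ∪ T') ∧ e ∈ I) := by
    intro e heF
    by_cases heI : e ∈ I
    · by_cases heT : e ∈ T
      · exact .inl ⟨ends_mono (by simpa using heT), .inr heI⟩
      by_cases heT' : e ∈ T'
      · exact .inr (.inl ⟨ends_mono (by simpa using heT'), .inr heI⟩)
      · exact .inr (.inr ⟨(ends_mono (by simp [heI, heT, heT'])).trans hR, heI⟩)
    · by_cases heA : e ∈ A
      exacts [.inl ⟨(key e heF heI).1 heA, .inl heA⟩,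
        .inr (.inl ⟨(key e heF heI).2 heA, .inl heA⟩)]
  have hclosed : ∀ W : Set α, (W = ends G T ∨ W = ends G T' ∨ W = ends G F \ ends G (T ∪ T')) →
      ∀ y z, (edgeSubgraph G F).Adj y z → y ∈ W → z ∈ W := by
    rintro W hW y z ⟨e, heF, he⟩ hy
    have hey : y ∈ ends G {e} := ⟨e, rfl, he.inc_left⟩
    have hez : z ∈ ends G {e} := ⟨e, rfl, he.inc_right⟩
    have hd := Set.disjoint_left.1 hdisj
    simp only [ends_union] at htri hW
    rcases htri e heF with ⟨h, -⟩ | ⟨h, -⟩ | ⟨h, -⟩ <;> have hy' := h hey <;> have hz' := h hez <;>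
      rcases hW with rfl | rfl | rfl <;> grind
  have hall : ∀ {e}, e ∈ F → ∀ {W}, (W = ends G T ∨ W = ends G T' ∨
      W = ends G F \ ends G (T ∪ T')) → ends G {e} ⊆ W → ends G F ⊆ W := by
    intro e heF W hW he
    obtain ⟨x, y, hxy⟩ := Graph.exists_isLink_of_mem_edgeSet (hFE heF)
    exact hF.subset_of_closed (x := x) ⟨e, heF, hxy.inc_left⟩ (he ⟨e, rfl, hxy.inc_left⟩)
      (hclosed W hW)
  have hends : ∀ {e}, e ∈ F → ∃ x ∈ ends G F, x ∈ ends G {e} := fun {e} heF ↦ by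
    obtain ⟨x, y, hxy⟩ := Graph.exists_isLink_of_mem_edgeSet (hFE heF)
    exact ⟨x, ⟨e, heF, hxy.inc_left⟩, e, rfl, hxy.inc_left⟩
  obtain ⟨g, hgF, hgI⟩ : ∃ g ∈ F, g ∉ I := by
    by_contra! h
    exact (hIc' h F subset_rfl).not_ge hcard
  -- V(T), V(T') and the remaining vertices are pairwise disjoint and closed under adjacency, so by
  -- connectedness one of them is everything. The edge g outside the basis excludes the third.
  have hside : ends G F ⊆ ends G T ∨ ends G F ⊆ ends G T' := by
    by_cases hgA : g ∈ A
    exacts [.inl (hall hgF (.inl rfl) ((key g hgF hgI).1 hgA)),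
      .inr (hall hgF (.inr (.inl rfl)) ((key g hgF hgI).2 hgA))]
  have hd := Set.disjoint_left.1 hdisj
  have hTF : ∀ {e}, e ∈ F → e ∈ I → (e ∈ T ∨ e ∈ T') := by
    intro e heF heI
    by_contra! h
    obtain ⟨x, hxF, hx⟩ := hends heF
    have := hR (ends_mono (show {e} ⊆ I \ (T ∪ T') by simp [heI, h.1, h.2]) hx)
    rw [ends_union] at this
    rcases hside with h | h
    exacts [this.2 (.inl (h hxF)), this.2 (.inr (h hxF))]
  have hmem : ∀ {e}, e ∈ F → (e ∈ A → ends G {e} ⊆ ends G T) ∧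
      (e ∉ A → ends G {e} ⊆ ends G T') := by
    intro e heF
    by_cases heI : e ∈ I
    · rcases hTF heF heI with h | h
      · exact ⟨fun _ ↦ ends_mono (by simpa using h), fun hA ↦ absurd (hTI h).2 hA⟩
      · exact ⟨fun hA ↦ absurd hA (hTI' h).2, fun _ ↦ ends_mono (by simpa using h)⟩
    · exact key e heF heI
  obtain ⟨a, haF, haA⟩ := hA
  obtain ⟨b, hbF, hbA⟩ := hA'
  obtain ⟨x, hxF, hx⟩ := hends haF
  obtain ⟨y, hyF, hy⟩ := hends hbF
  rcases hside with h | h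
  exacts [hd (h hyF) ((hmem hbF).2 hbA hy), hd ((hmem haF).1 haA hx) (h hxF)]

/-- Any two edges of a connected graph of minimum degree two and excess at least `k` lie in a
common circuit of the `k`-circular matroid. -/
theorem exists_isKCircuit_mem_mem {G : Graph α β} (hE : E(G).Finite) {k : ℕ} (hk : 1 ≤ k)
    {F : Set β} (hFE : F ⊆ E(G)) (hF : Connected (edgeSubgraph G F))
    (hdeg : ∀ x ∈ ends G F, 2 ≤ degree (edgeSubgraph G F) x)
    (hcard : (ends G F).ncard + k ≤ F.ncard) {e f : β} (he : e ∈ F) (hf : f ∈ F) :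
    ∃ C ⊆ F, IsKCircuit G k C ∧ e ∈ C ∧ f ∈ C := by
  induction k, hk using Nat.le_induction generalizing e f with
  | base =>
    have : (kCircularMatroid G hE 1 le_rfl).Finite := ⟨hE⟩
    -- The class of e under the common-circuit relation: by transitivity a circuit meeting it stays
    -- inside, so a crossing circuit is a contradiction.
    set A : Set β := {f | ∃ C ⊆ F, IsKCircuit G 1 C ∧ e ∈ C ∧ f ∈ C} with hA
    have hstep : ∀ C ⊆ F, IsKCircuit G 1 C → (C ∩ A).Nonempty → C ⊆ A := by
      rintro C hCF hC ⟨g, hgC, D, hDF, hD, heD, hgD⟩ x hx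
      rw [← kCircularMatroid_isCircuit_iff G hE 1 le_rfl] at hC hD
      obtain ⟨B, hB, hBc, heB, hxB⟩ := exists_isCircuit_trans hD hC ⟨g, hgD, hgC⟩ heD hx
      exact ⟨B, hB.trans (Set.union_subset hDF hCF),
        (kCircularMatroid_isCircuit_iff ..).1 hBc, heB, hxB⟩
    have heA : ∃ C ⊆ F, IsKCircuit G 1 C ∧ e ∈ C := by
      by_cases h : (F \ {e}).Nonempty
      · obtain ⟨C, hCF, hC, ⟨x, hxC, rfl⟩, -⟩ :=
          exists_circuit_crossing hE (A := {e}) hFE hF hdeg hcard ⟨e, he, rfl⟩ h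
        exact ⟨C, hCF, hC, hxC⟩
      · have hFe : F = {e} := (Set.sdiff_eq_empty.1 (Set.not_nonempty_iff_eq_empty.1 h)).antisymm
          (by simpa using he)
        have h1 : (ends G F).Nonempty := hF.1
        have h2 := (Set.ncard_pos (ends_finite G (hE.subset hFE))).2 h1
        rw [hFe, Set.ncard_singleton] at hcard
        rw [hFe] at h2
        omega
    obtain ⟨D, hDF, hD, heD⟩ := heA
    by_contra hfA
    obtain ⟨C, hCF, hC, hCA, x, hxC, hxA⟩ := exists_circuit_crossing hE (A := A) hFE hF hdeg hcard
      ⟨e, he, D, hDF, hD, heD, heD⟩ ⟨f, hf, hfA⟩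
    exact hxA (hstep C hCF hC hCA hxC)
  | succ i hi ih =>
    obtain ⟨D, hDF, hD, heD, hfD⟩ := ih (by omega) he hf
    obtain ⟨C, hCF, hC, hDC⟩ := hD.exists_superset hE hDF hFE hcard
    exact ⟨C, hCF, hC, hDC heD, hDC hfD⟩

/-! ### Rank of a union of circuits -/

lemma degree_edgeSubgraph_mono {G : Graph α β} {C F : Set β} (h : C ⊆ F) (x : α) :
    degree (edgeSubgraph G C) x ≤ degree (edgeSubgraph G F) x :=
  add_le_add (Set.encard_le_encard fun _ he ↦
      edgeSubgraph_inc.2 ⟨h (edgeSubgraph_inc.1 he).1, (edgeSubgraph_inc.1 he).2⟩)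
    (Set.encard_le_encard fun _ he ↦ ⟨h he.1, he.2⟩)

lemma two_le_of_ne_zero_of_ne_one {d : ℕ∞} (h₀ : d ≠ 0) (h₁ : d ≠ 1) : 2 ≤ d := by
  rw [← one_add_one_eq_two]
  exact Order.add_one_le_of_lt (lt_of_le_of_ne (Order.one_le_iff_pos.2 (pos_iff_ne_zero.2 h₀))
    h₁.symm)

/-- The rank of a nonempty set of edges that is a union of circuits. -/
lemma ncard_of_isBasis_of_forall_mem_circuit {G : Graph α β} {hE : E(G).Finite} {k : ℕ}
    {hk : 1 ≤ k} {F I : Set β} (hI : (kCircularMatroid G hE k hk).IsBasis I F) (hne : F.Nonempty)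
    (hF : ∀ f ∈ F, ∃ C ⊆ F, IsKCircuit G k C ∧ f ∈ C) : I.ncard + 1 = (ends G F).ncard + k := by
  have hFE : F ⊆ E(G) := hI.subset_ground
  have hFf := hE.subset hFE
  have hIF := hI.subset
  have hIf := hFf.subset hIF
  have hIc := ((indep_iff_count hE hk).1 hI.indep).2
  have hdeg : ∀ x ∈ ends G F, 2 ≤ degree (edgeSubgraph G F) x := by
    rintro x ⟨f, hf, hx⟩
    obtain ⟨C, hCF, hC, hfC⟩ := hF f hf
    exact (two_le_of_ne_zero_of_ne_one (hC.2.2.1 x ⟨f, hfC, hx⟩)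
      (hC.2.2.2.1 x ⟨f, hfC, hx⟩)).trans (degree_edgeSubgraph_mono hCF x)
  obtain ⟨g, hgF, hgI⟩ : ∃ g ∈ F, g ∉ I := by
    by_contra! h
    obtain ⟨f, hf⟩ := hne
    obtain ⟨C, hCF, hC, -⟩ := hF f hf
    exact hI.indep.2 C (hCF.trans h) hC
  have key : ∀ g ∈ F, g ∉ I → ∃ X ⊆ I, Tight G k X ∧ ends G {g} ⊆ ends G X := by
    intro g hgF hgI
    obtain ⟨C, hCI, hC, hgC⟩ := exists_circuit_of_isBasis hI hgF hgI
    obtain ⟨h1, h2⟩ := hC.tight_sdiff hE hgC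
    exact ⟨C \ {g}, by simpa using hCI, h1, h2 ▸ ends_mono (by simpa using hgC)⟩
  obtain ⟨X, hXI, hX, -⟩ := key g hgF hgI
  obtain ⟨T, hTI, hT, hTmax⟩ := exists_greatest_tight hIf hIc hX hXI
  have h1 := Set.ncard_sdiff_add_ncard_of_subset hTI hIf
  have h2 := Set.ncard_sdiff_add_ncard_of_subset (ends_mono (G := G) (hTI.trans hIF))
    (ends_finite G hFf)
  have h3 := hIc I subset_rfl
  have h4 := Set.ncard_le_ncard (ends_mono (G := G) hIF) (ends_finite G hFf)
  unfold Tight at hT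
  -- F need not be connected here. T spans all edges outside I, and the bounds on I and T give |I \
  -- T| ≤ |V(F) \ V(T)|. The degree count turns this into equality, which is the rank formula.
  have h5 := (ends_subset_sdiff hE (R := I \ T) (W := ends G T) hFE
    (Set.sdiff_subset.trans hIF) hdeg (fun e heF heR ↦ by
      by_cases heI : e ∈ I
      · have : e ∈ T := by
          by_contra h
          exact heR ⟨heI, h⟩
        exact ends_mono (by simpa using this)
      · obtain ⟨X, hXI, hX, heX⟩ := key e heF heI
        exact heX.trans (ends_mono (hTmax X hXI hX))) (by omega)).1
  omega

/-! ### Deleting vertices from a 3-connected graph -/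

/-- A `3`-connected graph has minimum degree at least two after the deletion of a vertex. -/
lemma two_le_degree_deleteVerts {G : Graph α β} (hG : IsThreeConnected G) {X : Set α}
    (hXV : X ⊆ V(G)) (hX : X.encard ≤ 1) {y : α} (hy : y ∈ V(G)) (hyX : y ∉ X) :
    2 ≤ degree (edgeSubgraph G E(G.deleteVerts X)) y := by
  set F := E(G.deleteVerts X) with hF
  have hmem : ∀ {e a b}, G.IsLink e a b → a ∉ X → b ∉ X → e ∈ F := fun h ha hb ↦ by
    rw [hF, Graph.edgeSet_deleteVerts]
    exact ⟨_, _, h, ha, hb⟩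
  have hnX : ∀ {e a b}, e ∈ F → G.IsLink e a b → b ∉ X := fun {e a b} he h ↦ by
    rw [hF, Graph.edgeSet_deleteVerts] at he
    obtain ⟨c, d, hcd, hc, hd⟩ := he
    rcases h.inc_right.eq_or_eq_of_isLink hcd with rfl | rfl <;> assumption
  -- otherwise `y` has at most one neighbour in `G \ X`
  obtain hdeg | ⟨Z, hZV, hZ, hyZ, hZe⟩ : 2 ≤ degree (edgeSubgraph G F) y ∨ ∃ Z ⊆ V(G),
      Z.encard ≤ 1 ∧ y ∉ Z ∧ ∀ e ∈ F, ∀ z, G.IsLink e y z → z ∈ Z := by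
    by_cases hinc : ((edgeSubgraph G F).incidenceSet y).encard ≤ 1
    · rcases Set.encard_le_one_iff_eq.1 hinc with h | ⟨e, h⟩
      · refine .inr ⟨∅, Set.empty_subset _, by simp, by simp, fun e he z hz ↦ ?_⟩
        exact (Set.eq_empty_iff_forall_notMem.1 h e (edgeSubgraph_inc.2 ⟨he, hz.inc_left⟩)).elim
      · have he : (edgeSubgraph G F).Inc e y := by
          have : e ∈ (edgeSubgraph G F).incidenceSet y := h ▸ rfl
          exact this
        obtain ⟨z, heF, hz⟩ := he
        -- A single incident edge suffices if it is a loop, which counts twice.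
        by_cases hzy : z = y
        · subst hzy
          have h1 : e ∈ (edgeSubgraph G F).loopSet z := ⟨heF, hz⟩
          have h2 : (1 : ℕ∞) ≤ ((edgeSubgraph G F).loopSet z).encard :=
            Set.one_le_encard_iff_nonempty.2 ⟨e, h1⟩
          refine .inl ?_
          rw [degree, h, Set.encard_singleton, ← one_add_one_eq_two]
          gcongr
        · refine .inr ⟨{z}, by simpa using hz.right_mem, by simp, fun h ↦ hzy h.symm,
            fun f hf w hw ↦ ?_⟩
          have : f ∈ (edgeSubgraph G F).incidenceSet y := edgeSubgraph_inc.2 ⟨hf, hw.inc_left⟩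
          rw [h, Set.mem_singleton_iff] at this
          subst this
          exact (hw.inc_right.eq_or_eq_of_isLink hz).resolve_left fun hwy ↦ by
            subst hwy
            exact hzy ((hz.inc_right.eq_or_eq_of_isLink hw).elim id id)
    · refine .inl (le_trans ?_ (le_self_add (a := ((edgeSubgraph G F).incidenceSet y).encard)))
      rw [← one_add_one_eq_two]
      exact Order.add_one_le_of_lt (not_le.1 hinc)
  · exact hdeg
  exfalso
  -- Deleting X and the only possible neighbour isolates y, yet one of the at least four vertices
  -- remains besides y.
  have hXZ : (X ∪ Z).encard ≤ 2 := (Set.encard_union_le _ _).trans (by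
    rw [← one_add_one_eq_two]
    gcongr)
  have hcon := hG.2 (X ∪ Z) (Set.union_subset hXV hZV) hXZ
  obtain ⟨w, hwV, hw⟩ : ∃ w ∈ V(G), w ∉ insert y (X ∪ Z) := by
    by_contra! h
    have h1 := (hG.1.trans (Set.encard_le_encard h)).trans (Set.encard_insert_le _ _)
    have h2 : (4 : ℕ∞) ≤ 2 + 1 := h1.trans (by gcongr)
    exact absurd h2 (by norm_num)
  rw [Set.mem_insert_iff, not_or] at hw
  have hyw := hcon.2 y (by simp [hy, hyX, hyZ]) w (by
    rw [Graph.vertexSet_deleteVerts]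
    exact ⟨hwV, hw.2⟩)
  rcases Relation.ReflTransGen.cases_head hyw with rfl | ⟨z, ⟨e, he⟩, -⟩
  · exact hw.1 rfl
  · rw [Graph.deleteVerts_isLink] at he
    exact he.2.2 (.inr (hZe e (hmem he.1 hyX fun h ↦ he.2.2 (.inl h)) z he.1))

/-- The degree bound rules out isolated vertices, so passing to the subgraph formed by the remaining
edges loses no vertex. -/
lemma ends_edgeSet_deleteVerts {G : Graph α β} (hG : IsThreeConnected G) {X : Set α}
    (hXV : X ⊆ V(G)) (hX : X.encard ≤ 1) : ends G E(G.deleteVerts X) = V(G) \ X := by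
  refine Set.Subset.antisymm ?_ fun y hy ↦ ?_
  · rintro x ⟨e, he, hx⟩
    rw [Graph.edgeSet_deleteVerts] at he
    obtain ⟨c, d, hcd, hc, hd⟩ := he
    refine ⟨hx.vertex_mem, ?_⟩
    rcases hx.eq_or_eq_of_isLink hcd with rfl | rfl <;> assumption
  · by_contra h
    have h2 := two_le_degree_deleteVerts hG hXV hX hy.1 hy.2
    have h1 : (edgeSubgraph G E(G.deleteVerts X)).incidenceSet y = ∅ :=
      Set.eq_empty_iff_forall_notMem.2 fun e he ↦ h ⟨e, edgeSubgraph_inc.1 he⟩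
    have h3 : (edgeSubgraph G E(G.deleteVerts X)).loopSet y = ∅ :=
      Set.eq_empty_iff_forall_notMem.2 fun e he ↦ h ⟨e, he.1, he.2.inc_left⟩
    rw [degree, h1, h3] at h2
    simp at h2

lemma connected_edgeSubgraph_deleteVerts {G : Graph α β} (hG : IsThreeConnected G) {X : Set α}
    (hXV : X ⊆ V(G)) (hX : X.encard ≤ 1) : Connected (edgeSubgraph G E(G.deleteVerts X)) := by
  have h := hG.2 X hXV (hX.trans (by norm_num))
  have hV : V(edgeSubgraph G E(G.deleteVerts X)) = V(G.deleteVerts X) := by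
    rw [Graph.vertexSet_deleteVerts]
    exact ends_edgeSet_deleteVerts hG hXV hX
  rw [Connected, hV]
  refine ⟨h.1, fun x hx y hy ↦ Relation.ReflTransGen.mono ?_ _ _ (h.2 x hx y hy)⟩
  rintro a b ⟨e, he⟩
  exact ⟨e, he.edge_mem, ((Graph.deleteVerts_isLink ..).1 he).1⟩

lemma edgeSet_deleteVerts_singleton (G : Graph α β) (x : α) :
    E(G.deleteVerts {x}) = E(G) \ G.incidenceSet x := by
  ext e
  rw [Graph.edgeSet_deleteVerts]
  constructor
  · rintro ⟨a, b, hab, ha, hb⟩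
    refine ⟨hab.edge_mem, fun h ↦ ?_⟩
    rcases Graph.Inc.eq_or_eq_of_isLink h hab with rfl | rfl
    exacts [ha rfl, hb rfl]
  · rintro ⟨he, hx⟩
    obtain ⟨a, b, hab⟩ := Graph.exists_isLink_of_mem_edgeSet he
    exact ⟨a, b, hab, fun h ↦ hx (h ▸ hab.inc_left), fun h ↦ hx (h ▸ hab.inc_right)⟩

/-! ### Bases, connected deletions and vertex stars -/

/-- The number of edges in a base of the `k`-circular matroid of a `3`-connected graph. -/
lemma ncard_of_isBase {G : Graph α β} {hE : E(G).Finite} {k : ℕ} {hk : 1 ≤ k}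
    (hG : IsThreeConnected G) (hΔ : V(G).ncard + k ≤ E(G).ncard) {B : Set β}
    (hB : (kCircularMatroid G hE k hk).IsBase B) : B.ncard + 1 = V(G).ncard + k := by
  have h1 := ends_edgeSet_deleteVerts hG (Set.empty_subset _) (by simp)
  have h2 := connected_edgeSubgraph_deleteVerts hG (Set.empty_subset _) (by simp)
  simp only [Graph.deleteVerts_empty, Set.sdiff_empty] at h1 h2
  have h := tight_of_isBasis h2 (by rwa [h1]) hB.isBasis_ground
  rw [← h1, ← h.2]
  exact h.1

/-- A matroid whose circuits have at least two elements is connected if any two of its elements lie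
in a common circuit. -/
lemma matroidConnected_of_forall {M : Matroid β} (hM : ∀ C, M.IsCircuit C → C.Nontrivial)
    (h : ∀ e ∈ M.E, ∀ f ∈ M.E, ∃ C, M.IsCircuit C ∧ e ∈ C ∧ f ∈ C) : MatroidConnected M := by
  refine ⟨fun e _ he ↦ ?_, fun e heE he ↦ ?_, h⟩
  · exact Set.not_nontrivial_singleton (hM _ (Matroid.singleton_isCircuit.2 he))
  · obtain ⟨C, hC, heC, -⟩ := h e heE e heE
    exact (Matroid.isColoop_iff_forall_notMem_isCircuit heE).1 he hC heC

lemma IsKCircuit.nontrivial {G : Graph α β} (hE : E(G).Finite) {k : ℕ} (hk : 1 ≤ k) {C : Set β}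
    (hC : IsKCircuit G k C) : C.Nontrivial := by
  have h := hC.count_le
  have hfin := hE.subset hC.1
  have hne : C.Nonempty := Set.nonempty_of_ncard_ne_zero (by omega)
  obtain ⟨e, he⟩ := hne
  obtain ⟨x, y, hxy⟩ := Graph.exists_isLink_of_mem_edgeSet (hC.1 he)
  have := (Set.ncard_pos (ends_finite G hfin)).2 ⟨x, e, he, hxy.inc_left⟩
  have := hfin.to_subtype
  exact Set.one_lt_ncard_iff_nontrivial.1 (by omega)

/-- Applied with K empty for the matroid itself and with K a vertex star for the deletion. -/
lemma matroidConnected_delete {G : Graph α β} (hE : E(G).Finite) {k : ℕ} (hk : 1 ≤ k)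
    {K : Set β} (hF : Connected (edgeSubgraph G (E(G) \ K)))
    (hdeg : ∀ x ∈ ends G (E(G) \ K), 2 ≤ degree (edgeSubgraph G (E(G) \ K)) x)
    (hcard : (ends G (E(G) \ K)).ncard + k ≤ (E(G) \ K).ncard) :
    MatroidConnected (kCircularMatroid G hE k hk ＼ K) := by
  refine matroidConnected_of_forall (fun C hC ↦ ?_) fun e he f hf ↦ ?_
  · exact ((kCircularMatroid_isCircuit_iff ..).1 hC.of_delete).nontrivial hE hk
  · obtain ⟨C, hCF, hC, heC, hfC⟩ :=
      exists_isKCircuit_mem_mem hE hk Set.sdiff_subset hF hdeg hcard he hf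
    exact ⟨C, Matroid.delete_isCircuit_iff.2 ⟨(kCircularMatroid_isCircuit_iff ..).2 hC,
      (Set.subset_sdiff.1 hCF).2⟩, heC, hfC⟩

/-- A base has |V| + k - 1 edges, one more than independence allows on the vertices other than x. -/
lemma incidenceSet_inter_nonempty {G : Graph α β} (hV : V(G).Finite) {hE : E(G).Finite} {k : ℕ}
    {hk : 1 ≤ k} (hG : IsThreeConnected G) (hΔ : V(G).ncard + k ≤ E(G).ncard) {x : α}
    (hx : x ∈ V(G)) {B : Set β} (hB : (kCircularMatroid G hE k hk).IsBase B) :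
    (G.incidenceSet x ∩ B).Nonempty := by
  by_contra h
  have h1 := ncard_of_isBase hG hΔ hB
  have h2 := ((indep_iff_count hE hk).1 hB.indep).2 B subset_rfl
  have h3 : ends G B ⊆ V(G) \ {x} := by
    rintro y ⟨e, he, hy⟩
    exact ⟨hy.vertex_mem, fun hyx ↦ h ⟨e, by rw [← hyx]; exact hy, he⟩⟩
  have h4 := Set.ncard_le_ncard h3 hV.sdiff
  have h5 := Set.ncard_sdiff_singleton_add_one hx hV
  omega

/-- Adding an edge at `x` to an independent set of edges that avoid `x` gives an independent
set. -/
lemma indep_insert_of_notMem_ends {G : Graph α β} {hE : E(G).Finite} {k : ℕ} {hk : 1 ≤ k}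
    {I : Set β} (hI : (kCircularMatroid G hE k hk).Indep I) {x : α} (hx : x ∉ ends G I) {s : β}
    (hs : G.Inc s x) : (kCircularMatroid G hE k hk).Indep (insert s I) := by
  rw [indep_iff_count] at hI ⊢
  have hIf := hE.subset hI.1
  refine ⟨Set.insert_subset hs.edge_mem hI.1, fun Y hY ↦ ?_⟩
  by_cases hsY : s ∈ Y
  · have hYf := (hIf.insert s).subset hY
    have h1 := hI.2 (Y \ {s}) (by simpa using hY)
    have h2 := Set.ncard_sdiff_singleton_add_one hsY hYf
    -- Removing s loses one edge and at least the vertex x, so the bound for the rest implies the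
    -- bound for Y.
    have h3 : ends G (Y \ {s}) ⊆ ends G Y \ {x} := by
      rintro y ⟨e, he, hy⟩
      refine ⟨⟨e, he.1, hy⟩, ?_⟩
      rintro rfl
      exact hx ⟨e, (hY he.1).resolve_left he.2, hy⟩
    have h4 := Set.ncard_le_ncard h3 (ends_finite G hYf).sdiff
    have h5 := Set.ncard_sdiff_singleton_add_one (s := ends G Y) ⟨s, hsY, hs⟩ (ends_finite G hYf)
    omega
  · exact hI.2 Y ((Set.subset_insert_iff_of_notMem hsY).1 hY)

end KCircular

/-! ### The main theorem -/

open KCircular in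
theorem mainTheorem7 {α β : Type*} (G : Graph α β) (hV : V(G).Finite) (hE : E(G).Finite)
    (k : ℕ) (hk : 1 ≤ k) (hG : KCircular.IsThreeConnected G)
    (hΔ : (k : ℤ) ≤ (E(G).ncard : ℤ) - (V(G).ncard : ℤ)) :
    {K : Set β | KCircular.IsNonseparatingCocircuit (KCircular.kCircularMatroid G hE k hk) K} =
      {S : Set β | KCircular.IsVertexStar G S ∧
        S.encard ≤ (KCircular.kCircularMatroid G hE k hk)✶.eRank} := by
  have hΔ' : V(G).ncard + k ≤ E(G).ncard := by omega
  have hn : 4 ≤ V(G).ncard := by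
    have := hG.1
    rw [← hV.cast_ncard_eq] at this
    exact_mod_cast this
  set M := kCircularMatroid G hE k hk with hM
  obtain ⟨B, hB⟩ := M.exists_isBase
  have hBE : B ⊆ E(G) := hB.subset_ground
  have hBcard := ncard_of_isBase hG hΔ' hB
  have hBc := Set.ncard_sdiff_add_ncard_of_subset hBE hE
  -- The corank is |E| - (|V| + k - 1). For the star of x the right-hand side says that G - x has
  -- excess at least k.
  have hrank : ∀ S ⊆ E(G), S.encard ≤ M✶.eRank ↔ V(G).ncard + k ≤ (E(G) \ S).ncard + 1 := by
    intro S hS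
    have h := Set.ncard_sdiff_add_ncard_of_subset hS hE
    rw [← hB.encard_compl_eq, hM, kCircularMatroid_ground, ← (hE.subset hS).cast_ncard_eq,
      ← hE.sdiff.cast_ncard_eq, Nat.cast_le]
    omega
  ext K
  simp only [Set.mem_ofPred_eq]
  constructor
  · rintro ⟨-, hK, hcon⟩
    have hKE : K ⊆ E(G) := hK.subset_ground
    have hKmin := Matroid.isCocircuit_iff_minimal.1 hK
    have hcirc : ∀ f ∈ E(G) \ K, ∃ C ⊆ E(G) \ K, IsKCircuit G k C ∧ f ∈ C := by
      intro f hf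
      obtain ⟨C, hC, hfC, -⟩ := hcon.2.2 f hf f hf
      exact ⟨C, hC.subset_ground, (kCircularMatroid_isCircuit_iff ..).1 hC.of_delete, hfC⟩
    obtain ⟨I, hI⟩ := M.exists_isBasis (E(G) \ K) Set.sdiff_subset
    have hIf := hE.subset hI.indep.subset_ground
    -- `E(G) \ K` is a hyperplane
    have hIlt : I.ncard < B.ncard := by
      obtain ⟨B', hB', hIB'⟩ := hI.indep.exists_isBase_superset
      have hB'c := ncard_of_isBase hG hΔ' hB'
      have hB'f := hE.subset hB'.subset_ground
      obtain ⟨g, hgK, hgB'⟩ := hKmin.prop B' hB'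
      have : I.ncard < B'.ncard := Set.ncard_lt_ncard
        ⟨hIB', fun h ↦ (hI.subset (h hgB')).2 hgK⟩ hB'f
      omega
    have hIle : B.ncard ≤ I.ncard + 1 := by
      obtain ⟨s, hs⟩ := hK.nonempty
      -- By minimality of K some base avoids K except possibly at s; without s it is an independent
      -- subset of the complement.
      obtain ⟨B', hB', hdisj⟩ : ∃ B', M.IsBase B' ∧ ¬ ((K \ {s}) ∩ B').Nonempty := by
        by_contra! h
        exact (hKmin.le_of_le (y := K \ {s}) h Set.sdiff_subset hs).2 rfl
      have hB'c := ncard_of_isBase hG hΔ' hB'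
      have h1 : B' \ {s} ⊆ E(G) \ K := fun e he ↦
        ⟨hB'.subset_ground he.1, fun h ↦ hdisj ⟨e, ⟨h, he.2⟩, he.1⟩⟩
      have h2 : M.Indep (B' \ {s}) := hB'.indep.subset Set.sdiff_subset
      have h3 := h2.encard_le_eRk_of_subset h1
      rw [hI.eRk_eq_encard, ← hIf.cast_ncard_eq,
        ← ((hE.subset hB'.subset_ground).sdiff).cast_ncard_eq, Nat.cast_le] at h3
      have h4 := Set.pred_ncard_le_ncard_sdiff_singleton B' s
      omega
    have hFne : (E(G) \ K).Nonempty := by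
      by_contra h
      have h1 := hI.subset
      rw [Set.not_nonempty_iff_eq_empty.1 h, Set.subset_empty_iff] at h1
      rw [h1, Set.ncard_empty] at hIle
      omega
    have hIcard := ncard_of_isBasis_of_forall_mem_circuit hI hFne hcirc
    -- The complement has rank |V(E \ K)| + k - 1, less than the full rank |V| + k - 1.
    obtain ⟨x, hxV, hx⟩ : ∃ x ∈ V(G), x ∉ ends G (E(G) \ K) := by
      by_contra! h
      have := Set.ncard_le_ncard h (ends_finite G hE.sdiff)
      omega
    have hstar : G.incidenceSet x ⊆ K := by
      intro e he
      by_contra heK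
      exact hx ⟨e, ⟨Graph.Inc.edge_mem he, heK⟩, he⟩
    refine ⟨⟨x, hxV, (hKmin.le_of_le (fun B hB ↦ incidenceSet_inter_nonempty hV hG hΔ' hxV hB)
      hstar).antisymm hstar⟩, (hrank K hKE).2 ?_⟩
    -- The complement contains a circuit, so it has more edges than its rank, which is one below
    -- full.
    have : I.ncard < (E(G) \ K).ncard := by
      refine Set.ncard_lt_ncard ⟨hI.subset, fun h ↦ ?_⟩ hE.sdiff
      obtain ⟨f, hf⟩ := hFne
      obtain ⟨C, hCF, hC, -⟩ := hcirc f hf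
      exact hI.indep.2 C (hCF.trans h) hC
    omega
  · rintro ⟨⟨x, hxV, rfl⟩, hcard⟩
    have hSE : G.incidenceSet x ⊆ E(G) := fun e he ↦ Graph.Inc.edge_mem he
    rw [hrank _ hSE] at hcard
    have hxs : ({x} : Set α) ⊆ V(G) := by simpa using hxV
    have h1 := ends_edgeSet_deleteVerts hG hxs (by simp)
    have h2 := connected_edgeSubgraph_deleteVerts hG hxs (by simp)
    have h3 := fun y (hy : y ∈ V(G) \ {x}) ↦
      two_le_degree_deleteVerts hG hxs (by simp) hy.1 hy.2
    have h1' := ends_edgeSet_deleteVerts hG (Set.empty_subset _) (by simp)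
    have h2' := connected_edgeSubgraph_deleteVerts hG (Set.empty_subset _) (by simp)
    have h3' := fun y (hy : y ∈ V(G)) ↦
      two_le_degree_deleteVerts hG (Set.empty_subset _) (by simp) hy (Set.notMem_empty y)
    simp only [Graph.deleteVerts_empty, Set.sdiff_empty] at h1' h2' h3'
    rw [edgeSet_deleteVerts_singleton] at h1 h2 h3
    have h4 := Set.ncard_sdiff_singleton_add_one hxV hV
    have h5 : (ends G (E(G) \ G.incidenceSet x)).ncard + k ≤ (E(G) \ G.incidenceSet x).ncard := by
      rw [h1]
      omega
    refine ⟨?_, ?_, matroidConnected_delete hE hk h2 (by rwa [h1]) h5⟩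
    · have h := matroidConnected_delete hE hk (K := ∅) (by rwa [Set.sdiff_empty])
        (by rwa [Set.sdiff_empty, h1']) (by rwa [Set.sdiff_empty, h1'])
      rwa [Matroid.delete_empty] at h
    · rw [Matroid.isCocircuit_iff_minimal]
      refine ⟨fun B hB ↦ incidenceSet_inter_nonempty hV hG hΔ' hxV hB, fun S hS hSx s hs ↦ ?_⟩
      -- A basis of G - x together with s is a base meeting the star only in s, so every S inside
      -- the star that meets all bases contains s.
      obtain ⟨I, hI⟩ := M.exists_isBasis (E(G) \ G.incidenceSet x) Set.sdiff_subset
      obtain ⟨ht, hends⟩ := tight_of_isBasis h2 h5 hI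
      have hxI : x ∉ ends G I := by
        rw [hends, h1]
        simp
      have hsI : s ∉ I := fun h ↦ (hI.subset h).2 hs
      have hIf := hE.subset hI.indep.subset_ground
      obtain ⟨B', hB', hsub⟩ := (indep_insert_of_notMem_ends hI.indep hxI hs).exists_isBase_superset
      have hB'c := ncard_of_isBase hG hΔ' hB'
      have hc := Set.ncard_insert_of_notMem hsI hIf
      have hB'eq := Set.eq_of_subset_of_ncard_le hsub (by
        unfold Tight at ht
        rw [hends, h1] at ht
        omega) (hE.subset hB'.subset_ground)
      obtain ⟨t, htS, htB⟩ := hS B' hB'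
      rw [← hB'eq] at htB
      rcases htB with rfl | htI
      exacts [htS, absurd (hSx htS) (hI.subset htI).2]
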